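/- Let $\mathbb{H}=\{z\in\mathbb{C}:\operatorname{Im} z>0\}$ and, for $\alpha>0$ and $z\in\mathbb{H}$, let $$\mathcal{K}(\alpha;z)=\sum_{(m,n)\in\mathbb{Z}^2}\frac{|mz+n|^2}{\operatorname{Im}(z)}\,e^{-\pi\alpha\frac{|mz+n|^2}{\operatorname{Im}(z)}},\qquad \Gamma_c=\Big\{z\in\mathbb{H}:\operatorname{Re}(z)=\tfrac12,\ \operatorname{Im}(z)\ge\tfrac{\sqrt3}{2}\Big\}.$$ Let $\alpha\ge 2$. Then: (1) For every real $b\ge 2\sqrt2$, the function $z\mapsto \mathcal{K}(\alpha;z)-b\,\mathcal{K}(2\alpha;z)$ has no minimizer on $\mathbb{H}$, i.e. there is no $z_0\in\mathbb{H}$ with $\mathcal{K}(\alpha;z_0)-b\,\mathcal{K}(2\alpha;z_0)\le \mathcal{K}(\alpha;z)-b\,\mathcal{K}(2\alpha;z)$ for all $z\in\mathbb{H}$. (2) For every real $b>2\sqrt2$, $\mathcal{K}(\alpha;z)-b\,\mathcal{K}(2\alpha;z)\to-\infty$ as $\operatorname{Im}(z)\to+\infty$, uniformly in $\operatorname{Re}(z)$.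 (3) For $b=2\sqrt2$, $\mathcal{K}(\alpha;z)-2\sqrt2\,\mathcal{K}(2\alpha;z)\to 0^+$ as $\operatorname{Im}(z)\to+\infty$, uniformly in $\operatorname{Re}(z)$ (that is, it tends to $0$ and is strictly positive once $\operatorname{Im}(z)$ is large enough), and $\mathcal{K}(\alpha;z)-2\sqrt2\,\mathcal{K}(2\alpha;z)>0$ for all $z\in\Gamma_c$. -/

import Mathlib

open UpperHalfPlane Filter Topology

/-- Squared length `|mz + n|² / Im z` of the point with integer coordinates `p = (m, n)` of the
unit-density lattice `(Im z)^(-1/2) (ℤ ⊕ zℤ)`. -/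
noncomputable def latticeNormSq (z : ℍ) (p : ℤ × ℤ) : ℝ :=
  ‖(p.1 : ℂ) * (z : ℂ) + (p.2 : ℂ)‖ ^ 2 / z.im

/-- `𝒦(α; z) = ∑_{(m,n) ∈ ℤ²} |mz+n|²/Im z · exp(-π α |mz+n|²/Im z)`. The family is summable
whenever `0 < α`, see `summable_latticeK`. -/
noncomputable def latticeK (α : ℝ) (z : ℍ) : ℝ :=
  ∑' p : ℤ × ℤ, latticeNormSq z p * Real.exp (-(Real.pi * α * latticeNormSq z p))

/-- The lattice energy `𝒦(α; z) - b 𝒦(2α; z)`. -/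
noncomputable def latticeEnergy (α b : ℝ) (z : ℍ) : ℝ :=
  latticeK α z - b * latticeK (2 * α) z

/-- The vertical half-line `Γ_c = {z ∈ ℍ : Re z = 1/2, Im z ≥ √3/2}`. -/
def GammaC : Set ℍ := {z | z.re = 1 / 2 ∧ Real.sqrt 3 / 2 ≤ z.im}

/-- The series defining `latticeK` converges, so its `tsum` is a genuine sum. -/
theorem summable_latticeK {α : ℝ} (hα : 0 < α) (z : ℍ) :
    Summable fun p : ℤ × ℤ =>
      latticeNormSq z p * Real.exp (-(Real.pi * α * latticeNormSq z p)) := by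
  have h0 : Summable fun v : Fin 2 → ℤ => ‖(v 0 : ℂ) * (z : ℂ) + (v 1 : ℂ)‖⁻¹ ^ 4 := by
    have h := EisensteinSeries.summable_norm_eisSummand (k := 4) (by norm_num) z
    refine h.congr fun v => ?_
    simp [EisensteinSeries.eisSummand, zpow_neg]
  have h1 : Summable fun p : ℤ × ℤ => ‖(p.1 : ℂ) * (z : ℂ) + (p.2 : ℂ)‖⁻¹ ^ 4 := by
    have h := (finTwoArrowEquiv ℤ).symm.summable_iff.mpr h0
    refine h.congr fun p => ?_
    simp [finTwoArrowEquiv]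
  have hz := z.im_pos
  have hc : 0 < Real.pi * α := mul_pos Real.pi_pos hα
  refine Summable.of_nonneg_of_le (fun p => ?_) (fun p => ?_)
    (h1.mul_left (6 / (Real.pi * α) ^ 3 * z.im ^ 2))
  · unfold latticeNormSq
    positivity
  · unfold latticeNormSq
    set r := ‖(p.1 : ℂ) * (z : ℂ) + (p.2 : ℂ)‖ with hr
    rcases (norm_nonneg ((p.1 : ℂ) * (z : ℂ) + (p.2 : ℂ))).eq_or_lt with h | h
    · rw [← hr] at h
      simp [← h]
    · rw [← hr] at h
      have ht : 0 < r ^ 2 / z.im := by positivity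
      have he := Real.pow_div_factorial_le_exp (Real.pi * α * (r ^ 2 / z.im)) (by positivity) 3
      have h6 : ((Nat.factorial 3 : ℕ) : ℝ) = 6 := by norm_num [Nat.factorial]
      rw [h6] at he
      have hpos : 0 < (Real.pi * α * (r ^ 2 / z.im)) ^ 3 / 6 := by positivity
      rw [Real.exp_neg]
      calc r ^ 2 / z.im * (Real.exp (Real.pi * α * (r ^ 2 / z.im)))⁻¹
          ≤ r ^ 2 / z.im * ((Real.pi * α * (r ^ 2 / z.im)) ^ 3 / 6)⁻¹ := by gcongr
        _ = 6 / (Real.pi * α) ^ 3 * z.im ^ 2 * r⁻¹ ^ 4 := by field_simp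

/-! The row `m = 0` of the lattice sum contributes `M(α/y)/y`, where `y = Im z` and `M` is
`thetaMoment`; the other rows tend to `0` at the cusp. By Poisson summation `t^(3/2) M(t) → 1/(2π)`
as `t → 0`, so `2√2 = 2^(3/2)` is exactly the factor at which the leading terms of `M(t)` and
`M(2t)` cancel. At `b = 2√2` the energy is positive on all of `ℍ`: `SL(2, ℤ)`-invariance reduces to
the fundamental domain, where `thetaMoment_two_mul_lt` handles the row `m = 0` and a termwise
comparison handles the rest. Its limit at the cusp is `0`, so no value is minimal. For larger `b`,
the extra `-(b - 2√2) 𝒦(2α; z)` drives the energy to `-∞`. -/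

/-! ### Theta series, its second moment and Poisson duality -/

/-- The theta series `∑ exp(-π t n²)`. -/
noncomputable def thetaSeries (t : ℝ) : ℝ :=
  ∑' n : ℤ, Real.exp (-Real.pi * t * (n : ℝ) ^ 2)

/-- The second moment `∑ n² exp(-π t n²)` of the theta series. -/
noncomputable def thetaMoment (t : ℝ) : ℝ :=
  ∑' n : ℤ, (n : ℝ) ^ 2 * Real.exp (-Real.pi * t * (n : ℝ) ^ 2)

theorem summable_pow_mul_theta {t : ℝ} (ht : 0 < t) (k : ℕ) :
    Summable fun n : ℤ => ((n : ℝ) ^ 2) ^ k * Real.exp (-Real.pi * t * (n : ℝ) ^ 2) := by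
  have h := summable_pow_mul_jacobiTheta₂_term_bound 0 ht (2 * k)
  refine h.congr fun n => ?_
  rw [Int.cast_abs, pow_mul, sq_abs]
  congr 2
  ring

theorem summable_thetaSeries {t : ℝ} (ht : 0 < t) :
    Summable fun n : ℤ => Real.exp (-Real.pi * t * (n : ℝ) ^ 2) := by
  simpa using summable_pow_mul_theta ht 0

theorem summable_thetaMoment {t : ℝ} (ht : 0 < t) :
    Summable fun n : ℤ => (n : ℝ) ^ 2 * Real.exp (-Real.pi * t * (n : ℝ) ^ 2) := by
  simpa using summable_pow_mul_theta ht 1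

theorem hasDerivAt_thetaSeries {t : ℝ} (ht : 0 < t) :
    HasDerivAt thetaSeries (-Real.pi * thetaMoment t) t := by
  have hu : Summable fun n : ℤ =>
      Real.pi * ((n : ℝ) ^ 2 * Real.exp (-Real.pi * (t / 2) * (n : ℝ) ^ 2)) :=
    (summable_thetaMoment (half_pos ht)).mul_left _
  -- On `(t/2, ∞)` the differentiated terms are dominated by their values at `t/2`.
  have h := hasDerivAt_tsum_of_isPreconnected (t := Set.Ioi (t / 2)) (y₀ := t) (y := t)
    (g := fun (n : ℤ) s => Real.exp (-Real.pi * s * (n : ℝ) ^ 2))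
    (g' := fun (n : ℤ) s => -Real.pi * ((n : ℝ) ^ 2 * Real.exp (-Real.pi * s * (n : ℝ) ^ 2)))
    hu isOpen_Ioi isPreconnected_Ioi (fun n s _ => ?_) (fun n s hs => ?_)
    (half_lt_self ht) (summable_thetaSeries ht) (half_lt_self ht)
  · rw [tsum_mul_left] at h
    exact h
  · have h1 : HasDerivAt (fun s : ℝ => -Real.pi * s * (n : ℝ) ^ 2)
        (-Real.pi * 1 * (n : ℝ) ^ 2) s :=
      ((hasDerivAt_id s).const_mul (-Real.pi)).mul_const _
    exact h1.exp.congr_deriv (by ring)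
  · have hs' : t / 2 < s := hs
    rw [norm_mul, norm_neg, Real.norm_of_nonneg Real.pi_pos.le,
      Real.norm_of_nonneg (by positivity)]
    have hp := Real.pi_pos
    gcongr ?_ * (?_ * Real.exp ?_)
    have : Real.pi * (t / 2) * (n : ℝ) ^ 2 ≤ Real.pi * s * (n : ℝ) ^ 2 := by gcongr
    linarith

theorem thetaSeries_inv {t : ℝ} (ht : 0 < t) :
    thetaSeries t = (Real.sqrt t)⁻¹ * thetaSeries t⁻¹ := by
  have h := Real.tsum_exp_neg_mul_int_sq ht
  rw [← Real.sqrt_eq_rpow, one_div] at h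
  simpa only [thetaSeries, div_eq_mul_inv] using h

/-- Differentiate both sides of the functional equation `thetaSeries_inv` and compare. -/
theorem thetaMoment_inv {t : ℝ} (ht : 0 < t) :
    t * Real.sqrt t * thetaMoment t =
      thetaSeries t⁻¹ / (2 * Real.pi) - thetaMoment t⁻¹ / t := by
  have hs : 0 < Real.sqrt t := Real.sqrt_pos.mpr ht
  have hsq : Real.sqrt t ^ 2 = t := Real.sq_sqrt ht.le
  have h1 := hasDerivAt_thetaSeries ht
  have h2 : HasDerivAt (fun s : ℝ => (Real.sqrt s)⁻¹ * thetaSeries s⁻¹)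
      (-(1 / (2 * Real.sqrt t)) / Real.sqrt t ^ 2 * thetaSeries t⁻¹ +
        (Real.sqrt t)⁻¹ * (-Real.pi * thetaMoment t⁻¹ * (-(t ^ 2)⁻¹))) t :=
    ((Real.hasDerivAt_sqrt ht.ne').inv hs.ne').mul
      ((hasDerivAt_thetaSeries (inv_pos.mpr ht)).comp t (hasDerivAt_inv ht.ne'))
  have h3 : thetaSeries =ᶠ[𝓝 t] fun s : ℝ => (Real.sqrt s)⁻¹ * thetaSeries s⁻¹ := by
    filter_upwards [lt_mem_nhds ht] with s hs using thetaSeries_inv hs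
  have h4 := h1.unique (h2.congr_of_eventuallyEq h3)
  have hp := Real.pi_pos
  have h5 : thetaMoment t = -(1 / Real.pi) * (-Real.pi * thetaMoment t) := by field_simp
  rw [h5, h4]
  generalize thetaSeries t⁻¹ = A
  generalize thetaMoment t⁻¹ = B
  generalize Real.sqrt t = s at *
  subst hsq
  field_simp
  ring

/-- The term `k = 0` is `1/(2π)` for every `t`, so it drops out when `t` and `2t` are compared. -/
theorem hasSum_thetaMoment_inv {t : ℝ} (ht : 0 < t) :
    HasSum (fun k : ℤ => (1 / (2 * Real.pi) - (k : ℝ) ^ 2 / t) *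
      Real.exp (-(Real.pi * (k : ℝ) ^ 2 / t))) (t * Real.sqrt t * thetaMoment t) := by
  rw [thetaMoment_inv ht]
  have hi := inv_pos.mpr ht
  have h := ((summable_thetaSeries hi).hasSum.div_const (2 * Real.pi)).sub
    ((summable_thetaMoment hi).hasSum.div_const t)
  refine h.congr_fun fun k => ?_
  have : -(Real.pi * (k : ℝ) ^ 2 / t) = -Real.pi * t⁻¹ * (k : ℝ) ^ 2 := by
    field_simp
  rw [this]
  ring

/-! ### The moment inequality between `t` and `2t` -/

theorem two_sqrt_two_lt_three : 2 * Real.sqrt 2 < 3 := by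
  nlinarith [Real.sqrt_nonneg 2, Real.sq_sqrt (show (0 : ℝ) ≤ 2 by norm_num)]

theorem mul_exp_lt_exp_of_two_le {u : ℝ} (hu : 2 ≤ u) :
    2 * Real.sqrt 2 * Real.exp (-(2 * u)) < Real.exp (-u) := by
  have h1 : Real.exp (-(2 * u)) = Real.exp (-u) * Real.exp (-u) := by
    rw [← Real.exp_add]; ring_nf
  have h2 : 2 * Real.sqrt 2 * Real.exp (-u) < 1 := by
    rw [Real.exp_neg, ← div_eq_mul_inv, div_lt_one (Real.exp_pos u)]
    linarith [Real.add_one_le_exp u, two_sqrt_two_lt_three]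
  rw [h1]
  nlinarith [Real.exp_pos (-u)]

/-- After division by `exp (-2s)` this is `4s - 1 < (2s - 1) exp s`, which follows from `exp s ≥ 1 +
s + s²/2`. -/
theorem moment_dual_term_lt {s : ℝ} (hs : 3 / 2 ≤ s) :
    (1 - 2 * s) * Real.exp (-s) < (1 - 4 * s) * Real.exp (-(2 * s)) := by
  have h1 : Real.exp (-s) = Real.exp (-(2 * s)) * Real.exp s := by
    rw [← Real.exp_add]; ring_nf
  have h2 := Real.quadratic_le_exp_of_nonneg (show 0 ≤ s by linarith)
  have h3 : (4 * s - 1) < (2 * s - 1) * Real.exp s := by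
    have : (2 * s - 1) * (1 + s + s ^ 2 / 2) ≤ (2 * s - 1) * Real.exp s := by
      gcongr; linarith
    nlinarith [mul_nonneg (show 0 ≤ s by linarith) (show 0 ≤ s - 3 / 2 by linarith),
      mul_nonneg (mul_nonneg (show 0 ≤ s by linarith) (show 0 ≤ s by linarith))
        (show 0 ≤ s - 3 / 2 by linarith)]
  rw [h1]
  nlinarith [Real.exp_pos (-(2 * s))]

theorem mul_sqrt_two_mul {t : ℝ} :
    (2 * t) * Real.sqrt (2 * t) = 2 * Real.sqrt 2 * (t * Real.sqrt t) := by
  rw [Real.sqrt_mul (by norm_num)]; ring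

/-- For `t ≥ 1` the series compare term by term; for `t ≤ 1` the dual series do, with `s = πk²/(2t)
≥ 3/2`. -/
theorem thetaMoment_two_mul_lt {t : ℝ} (ht : 0 < t) :
    2 * Real.sqrt 2 * thetaMoment (2 * t) < thetaMoment t := by
  have ht2 : 0 < 2 * t := by linarith
  have hp := Real.pi_gt_three
  have one_le : ∀ n : ℤ, n ≠ 0 → (1 : ℝ) ≤ (n : ℝ) ^ 2 := fun n hn => by
    exact_mod_cast Int.one_le_abs (pow_ne_zero 2 hn) |>.trans_eq (abs_of_nonneg (sq_nonneg n))
  rcases le_total 1 t with h | h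
  · have key : ∀ n : ℤ, n ≠ 0 →
        2 * Real.sqrt 2 * ((n : ℝ) ^ 2 * Real.exp (-Real.pi * (2 * t) * (n : ℝ) ^ 2)) <
          (n : ℝ) ^ 2 * Real.exp (-Real.pi * t * (n : ℝ) ^ 2) := fun n hn => by
      have h1 := one_le n hn
      have hu : 2 ≤ Real.pi * t * (n : ℝ) ^ 2 := by
        have : (3 : ℝ) * 1 * 1 ≤ Real.pi * t * (n : ℝ) ^ 2 := by gcongr
        linarith
      have h2 := mul_exp_lt_exp_of_two_le hu
      have e1 : -Real.pi * (2 * t) * (n : ℝ) ^ 2 = -(2 * (Real.pi * t * (n : ℝ) ^ 2)) := by ring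
      have e2 : -Real.pi * t * (n : ℝ) ^ 2 = -(Real.pi * t * (n : ℝ) ^ 2) := by ring
      rw [e1, e2, mul_left_comm]
      gcongr
    unfold thetaMoment
    rw [← tsum_mul_left]
    refine Summable.tsum_lt_tsum (i := 1) (fun n => ?_) (key 1 one_ne_zero)
      ((summable_thetaMoment ht2).mul_left _) (summable_thetaMoment ht)
    rcases eq_or_ne n 0 with rfl | hn
    · simp
    · exact (key n hn).le
  · have key : ∀ k : ℤ, k ≠ 0 →
        (1 / (2 * Real.pi) - (k : ℝ) ^ 2 / (2 * t)) * Real.exp (-(Real.pi * (k : ℝ) ^ 2 / (2 * t)))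
        < (1 / (2 * Real.pi) - (k : ℝ) ^ 2 / t) * Real.exp (-(Real.pi * (k : ℝ) ^ 2 / t)) :=
      fun k hk => by
      have h1 := one_le k hk
      have hs : 3 / 2 ≤ Real.pi * (k : ℝ) ^ 2 / (2 * t) := by
        have : (3 : ℝ) * 1 / (2 * 1) ≤ Real.pi * (k : ℝ) ^ 2 / (2 * t) := by gcongr
        linarith
      have h2 := moment_dual_term_lt hs
      have e1 : 1 / (2 * Real.pi) - (k : ℝ) ^ 2 / (2 * t) =
          1 / (2 * Real.pi) * (1 - 2 * (Real.pi * (k : ℝ) ^ 2 / (2 * t))) := by field_simp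
      have e2 : 1 / (2 * Real.pi) - (k : ℝ) ^ 2 / t =
          1 / (2 * Real.pi) * (1 - 4 * (Real.pi * (k : ℝ) ^ 2 / (2 * t))) := by
        field_simp; ring
      have e3 : Real.pi * (k : ℝ) ^ 2 / t = 2 * (Real.pi * (k : ℝ) ^ 2 / (2 * t)) := by field_simp
      rw [e1, e2, e3, mul_assoc, mul_assoc]
      gcongr
    have hlt := hasSum_lt (i := 1) (fun k => ?_) (key 1 one_ne_zero)
      (hasSum_thetaMoment_inv ht2) (hasSum_thetaMoment_inv ht)
    · rw [mul_sqrt_two_mul] at hlt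
      have hpos : 0 < t * Real.sqrt t := by positivity
      refine lt_of_mul_lt_mul_left (a := t * Real.sqrt t) ?_ hpos.le
      linarith
    · rcases eq_or_ne k 0 with rfl | hk
      · simp
      · exact (key k hk).le

/-! ### Asymptotics of the moment as `t → 0` -/

theorem exists_abs_thetaMoment_sub_le :
    ∃ C : ℝ, ∀ t : ℝ, 0 < t →
      |t * Real.sqrt t * thetaMoment t - 1 / (2 * Real.pi)| ≤ C * t := by
  have hS : Summable fun k : ℤ => 1 / (k : ℝ) ^ 2 :=
    Real.summable_one_div_int_pow.mpr one_lt_two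
  refine ⟨∑' k : ℤ, 1 / (k : ℝ) ^ 2, fun t ht => ?_⟩
  have hp := Real.pi_gt_three
  have h1 := (hasSum_thetaMoment_inv ht).sub (hasSum_ite_eq (0 : ℤ) (1 / (2 * Real.pi)))
  rw [← h1.tsum_eq, ← Real.norm_eq_abs]
  refine tsum_of_norm_bounded (hS.hasSum.mul_right t) fun k => ?_
  rcases eq_or_ne k 0 with rfl | hk
  · simp
  · rw [if_neg hk, sub_zero]
    have hk2 : 0 < (k : ℝ) ^ 2 := by positivity
    set u := Real.pi * (k : ℝ) ^ 2 / t with hu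
    have hu0 : 0 < u := by positivity
    have e1 : 1 / (2 * Real.pi) - (k : ℝ) ^ 2 / t = 1 / (2 * Real.pi) * (1 - 2 * u) := by
      rw [hu]; field_simp
    have e2 : 1 / (k : ℝ) ^ 2 * t = Real.pi / u := by rw [hu]; field_simp
    have h2 := Real.quadratic_le_exp_of_nonneg hu0.le
    have h3 : |1 - 2 * u| ≤ 1 + 2 * u := abs_le.mpr ⟨by linarith, by linarith⟩
    have h4 : u * (1 + 2 * u) ≤ 4 * Real.exp u := by nlinarith
    have h5 : 1 / (2 * Real.pi) ≤ 1 / 6 := one_div_le_one_div_of_le (by norm_num) (by linarith)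
    rw [e1, e2, norm_mul, norm_mul, Real.norm_of_nonneg (by positivity),
      Real.norm_of_nonneg (Real.exp_pos _).le, Real.norm_eq_abs, Real.exp_neg, ← div_eq_mul_inv,
      div_le_div_iff₀ (Real.exp_pos u) hu0]
    calc 1 / (2 * Real.pi) * |1 - 2 * u| * u ≤ 1 / 6 * (1 + 2 * u) * u := by gcongr
      _ ≤ Real.exp u := by nlinarith [Real.exp_pos u]
      _ ≤ Real.pi * Real.exp u := by nlinarith [Real.exp_pos u]

theorem tendsto_thetaMoment_sub :
    Tendsto (fun t => t * (thetaMoment t - 2 * Real.sqrt 2 * thetaMoment (2 * t)))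
      (𝓝[>] 0) (𝓝 0) := by
  obtain ⟨C, hC⟩ := exists_abs_thetaMoment_sub_le
  have h0 : Tendsto (fun t : ℝ => 3 * C * Real.sqrt t) (𝓝[>] 0) (𝓝 0) := by
    have : Continuous fun t : ℝ => 3 * C * Real.sqrt t := by fun_prop
    simpa using (this.tendsto 0).mono_left nhdsWithin_le_nhds
  refine squeeze_zero_norm' ?_ h0
  filter_upwards [self_mem_nhdsWithin] with t ht
  have ht : 0 < t := ht
  have h1 := abs_le.mp (hC t ht)
  have h2 := abs_le.mp (hC (2 * t) (by linarith))
  rw [mul_sqrt_two_mul] at h2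
  have hs : 0 < Real.sqrt t := Real.sqrt_pos.mpr ht
  have hsq : Real.sqrt t * Real.sqrt t = t := Real.mul_self_sqrt ht.le
  -- The two constants `1/(2π)` cancel, and the errors `C t` and `2 C t` add up to `3 C t`.
  have h3 : |Real.sqrt t * (t * (thetaMoment t - 2 * Real.sqrt 2 * thetaMoment (2 * t)))| ≤
      Real.sqrt t * (3 * C * Real.sqrt t) := by
    have : Real.sqrt t * (3 * C * Real.sqrt t) = 3 * C * t := by
      linear_combination 3 * C * hsq
    rw [this, abs_le]
    constructor <;> nlinarith
  rw [abs_mul, abs_of_pos hs] at h3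
  exact le_of_mul_le_mul_left h3 hs

theorem tendsto_mul_thetaMoment_atTop :
    Tendsto (fun t => t * thetaMoment t) (𝓝[>] 0) atTop := by
  obtain ⟨C, hC⟩ := exists_abs_thetaMoment_sub_le
  have h0 : Tendsto (fun t : ℝ => 1 / (2 * Real.pi) - C * t) (𝓝[>] 0)
      (𝓝 (1 / (2 * Real.pi))) := by
    have : Continuous fun t : ℝ => 1 / (2 * Real.pi) - C * t := by fun_prop
    simpa using (this.tendsto 0).mono_left nhdsWithin_le_nhds
  have h1 : Tendsto (fun t : ℝ => (Real.sqrt t)⁻¹) (𝓝[>] 0) atTop := by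
    refine tendsto_inv_nhdsGT_zero.comp (tendsto_nhdsWithin_iff.mpr ⟨?_, ?_⟩)
    · simpa using (Real.continuous_sqrt.tendsto 0).mono_left nhdsWithin_le_nhds
    · filter_upwards [self_mem_nhdsWithin] with t ht using Real.sqrt_pos.mpr ht
  refine tendsto_atTop_mono' _ ?_ (h0.pos_mul_atTop (by positivity) h1)
  filter_upwards [self_mem_nhdsWithin] with t ht
  have hs : 0 < Real.sqrt t := Real.sqrt_pos.mpr ht
  have h2 := abs_le.mp (hC t ht)
  rw [← div_eq_mul_inv, div_le_iff₀ hs]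
  linarith

/-! ### Lattice norms and modular invariance -/

theorem latticeNormSq_nonneg (z : ℍ) (p : ℤ × ℤ) : 0 ≤ latticeNormSq z p :=
  div_nonneg (sq_nonneg _) z.im_pos.le

theorem latticeNormSq_zero_left (z : ℍ) (n : ℤ) :
    latticeNormSq z (0, n) = (n : ℝ) ^ 2 / z.im := by
  simp [latticeNormSq]

theorem abs_mul_im_le_norm (z : ℍ) (p : ℤ × ℤ) :
    |(p.1 : ℝ)| * z.im ≤ ‖(p.1 : ℂ) * (z : ℂ) + (p.2 : ℂ)‖ := by
  have h := Complex.abs_im_le_norm ((p.1 : ℂ) * (z : ℂ) + (p.2 : ℂ))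
  simpa [abs_mul, abs_of_pos z.im_pos] using h

theorem im_le_norm {p : ℤ × ℤ} (hp : p.1 ≠ 0) (z : ℍ) :
    z.im ≤ ‖(p.1 : ℂ) * (z : ℂ) + (p.2 : ℂ)‖ := by
  refine le_trans ?_ (abs_mul_im_le_norm z p)
  have h : (1 : ℝ) ≤ |(p.1 : ℝ)| := by exact_mod_cast Int.one_le_abs hp
  nlinarith [z.im_pos]

theorem im_le_latticeNormSq {p : ℤ × ℤ} (hp : p.1 ≠ 0) (z : ℍ) : z.im ≤ latticeNormSq z p := by
  rw [latticeNormSq, le_div_iff₀ z.im_pos, ← sq]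
  exact pow_le_pow_left₀ z.im_pos.le (im_le_norm hp z) 2

/-- The linear change of lattice coordinates induced by `g ∈ SL(2, ℤ)`. -/
def coordEquiv (g : Matrix.SpecialLinearGroup (Fin 2) ℤ) : ℤ × ℤ ≃ ℤ × ℤ where
  toFun p := (p.1 * g 0 0 + p.2 * g 1 0, p.1 * g 0 1 + p.2 * g 1 1)
  invFun p := (p.1 * g 1 1 - p.2 * g 1 0, p.2 * g 0 0 - p.1 * g 0 1)
  left_inv p := by
    have h := g.det_coe
    rw [Matrix.det_fin_two] at h
    ext
    · linear_combination p.1 * h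
    · linear_combination p.2 * h
  right_inv p := by
    have h := g.det_coe
    rw [Matrix.det_fin_two] at h
    ext
    · linear_combination p.1 * h
    · linear_combination p.2 * h

theorem latticeNormSq_smul (g : Matrix.SpecialLinearGroup (Fin 2) ℤ) (z : ℍ) (p : ℤ × ℤ) :
    latticeNormSq (g • z) p = latticeNormSq z (coordEquiv g p) := by
  have hd : ((g 1 0 : ℤ) : ℂ) * (z : ℂ) + ((g 1 1 : ℤ) : ℂ) ≠ 0 := by
    have := denom_ne_zero g z
    simpa [ModularGroup.denom_apply] using this
  have him : (g • z).im = z.im / ‖((g 1 0 : ℤ) : ℂ) * (z : ℂ) + ((g 1 1 : ℤ) : ℂ)‖ ^ 2 := by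
    rw [ModularGroup.im_smul_eq_div_normSq, ModularGroup.denom_apply, Complex.normSq_eq_norm_sq]
  have hc : ((g • z : ℍ) : ℂ) = (((g 0 0 : ℤ) : ℂ) * z + ((g 0 1 : ℤ) : ℂ)) /
      (((g 1 0 : ℤ) : ℂ) * z + ((g 1 1 : ℤ) : ℂ)) := by
    simpa using coe_specialLinearGroup_apply g z
  have hn : (p.1 : ℂ) * ((g • z : ℍ) : ℂ) + (p.2 : ℂ) =
      (((coordEquiv g p).1 : ℂ) * z + ((coordEquiv g p).2 : ℂ)) /
      (((g 1 0 : ℤ) : ℂ) * z + ((g 1 1 : ℤ) : ℂ)) := by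
    rw [hc, eq_div_iff hd, add_mul, mul_assoc, div_mul_cancel₀ _ hd]
    simp only [coordEquiv, Equiv.coe_fn_mk]
    push_cast
    ring
  have hz := z.im_pos
  have hd' : ‖((g 1 0 : ℤ) : ℂ) * (z : ℂ) + ((g 1 1 : ℤ) : ℂ)‖ ≠ 0 := norm_ne_zero_iff.mpr hd
  rw [latticeNormSq, latticeNormSq, hn, him, norm_div]
  generalize ‖((g 1 0 : ℤ) : ℂ) * (z : ℂ) + ((g 1 1 : ℤ) : ℂ)‖ = d at *
  field_simp

theorem latticeK_smul (α : ℝ) (g : Matrix.SpecialLinearGroup (Fin 2) ℤ) (z : ℍ) :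
    latticeK α (g • z) = latticeK α z := by
  simp only [latticeK, latticeNormSq_smul]
  exact (coordEquiv g).tsum_eq fun p =>
    latticeNormSq z p * Real.exp (-(Real.pi * α * latticeNormSq z p))

theorem latticeEnergy_smul (α b : ℝ) (g : Matrix.SpecialLinearGroup (Fin 2) ℤ) (z : ℍ) :
    latticeEnergy α b (g • z) = latticeEnergy α b z := by
  simp only [latticeEnergy, latticeK_smul]

/-! ### Splitting off the row `m = 0`; positivity at `b = 2√2` -/

/-- The contribution to `latticeK` of the lattice points off the real axis. -/
noncomputable def latticeKOff (α : ℝ) (z : ℍ) : ℝ :=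
  ∑' p : ℤ × ℤ, if p.1 = 0 then 0 else
    latticeNormSq z p * Real.exp (-(Real.pi * α * latticeNormSq z p))

theorem summable_latticeKOff {α : ℝ} (hα : 0 < α) (z : ℍ) :
    Summable fun p : ℤ × ℤ => if p.1 = 0 then 0 else
      latticeNormSq z p * Real.exp (-(Real.pi * α * latticeNormSq z p)) := by
  refine Summable.of_nonneg_of_le (fun p => ?_) (fun p => ?_) (summable_latticeK hα z)
  all_goals
    have := mul_nonneg (latticeNormSq_nonneg z p)
      (Real.exp_pos (-(Real.pi * α * latticeNormSq z p))).le
    split_ifs <;> simp [this]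

theorem latticeKOff_nonneg (α : ℝ) (z : ℍ) : 0 ≤ latticeKOff α z := by
  refine tsum_nonneg fun p => ?_
  split_ifs
  · exact le_rfl
  · exact mul_nonneg (latticeNormSq_nonneg z p) (Real.exp_pos _).le

theorem latticeK_eq {α : ℝ} (hα : 0 < α) (z : ℍ) :
    latticeK α z = thetaMoment (α / z.im) / z.im + latticeKOff α z := by
  have hz := z.im_pos
  set F : ℤ × ℤ → ℝ := fun p =>
    latticeNormSq z p * Real.exp (-(Real.pi * α * latticeNormSq z p)) with hF
  have hinj : Function.Injective fun n : ℤ => ((0, n) : ℤ × ℤ) := fun a b h => by simpa using h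
  have h1 : HasSum (fun n : ℤ => F (0, n)) (thetaMoment (α / z.im) / z.im) := by
    refine ((summable_thetaMoment (div_pos hα hz)).hasSum.div_const z.im).congr_fun fun n => ?_
    simp only [hF, latticeNormSq_zero_left]
    have : -(Real.pi * α * ((n : ℝ) ^ 2 / z.im)) = -Real.pi * (α / z.im) * (n : ℝ) ^ 2 := by ring
    rw [this]
    ring
  have h2 : HasSum (fun p : ℤ × ℤ => if p.1 = 0 then F p else 0)
      (thetaMoment (α / z.im) / z.im) := by
    refine (hinj.hasSum_iff fun p hp => ?_).mp ?_
    · rw [if_neg]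
      rintro h
      exact hp ⟨p.2, by ext <;> simp [h]⟩
    · simpa [Function.comp_def] using h1
  have h3 := h2.add (summable_latticeKOff hα z).hasSum
  refine (HasSum.tsum_eq ?_)
  refine h3.congr_fun fun p => ?_
  split_ifs <;> simp [hF]

/-- `latticeK` is invariant under `T ^ n`, and the row `m = 0` depends only on `Im z`, so it
cancels. -/
theorem latticeKOff_vadd {α : ℝ} (hα : 0 < α) (n : ℤ) (z : ℍ) :
    latticeKOff α ((n : ℝ) +ᵥ z) = latticeKOff α z := by
  have h := latticeK_smul α (ModularGroup.T ^ n) z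
  rw [modular_T_zpow_smul, latticeK_eq hα, latticeK_eq hα, vadd_im] at h
  exact add_left_cancel h

theorem two_sqrt_two_mul_latticeKOff_le {α : ℝ} (hα : 2 ≤ α) {z : ℍ} (hz : 1 / 2 ≤ z.im) :
    2 * Real.sqrt 2 * latticeKOff (2 * α) z ≤ latticeKOff α z := by
  unfold latticeKOff
  rw [← tsum_mul_left]
  refine Summable.tsum_le_tsum (fun p => ?_)
    ((summable_latticeKOff (by linarith) z).mul_left _) (summable_latticeKOff (by linarith) z)
  split_ifs with hp
  · simp
  · have hQ := im_le_latticeNormSq hp z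
    have hpi := Real.pi_gt_three
    have hu : 2 ≤ Real.pi * α * latticeNormSq z p := by
      have : (3 : ℝ) * 2 * (1 / 2) ≤ Real.pi * α * latticeNormSq z p := by
        gcongr
        linarith
      linarith
    have h := mul_exp_lt_exp_of_two_le hu
    have e : Real.pi * (2 * α) * latticeNormSq z p = 2 * (Real.pi * α * latticeNormSq z p) := by
      ring
    rw [e, mul_left_comm]
    exact mul_le_mul_of_nonneg_left h.le (latticeNormSq_nonneg z p)

theorem latticeEnergy_pos_of_half_le_im {α : ℝ} (hα : 2 ≤ α) {z : ℍ} (hz : 1 / 2 ≤ z.im) :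
    0 < latticeEnergy α (2 * Real.sqrt 2) z := by
  have h1 := two_sqrt_two_mul_latticeKOff_le hα hz
  have h2 := thetaMoment_two_mul_lt (div_pos (show 0 < α by linarith) z.im_pos)
  have h3 := div_lt_div_of_pos_right h2 z.im_pos
  rw [latticeEnergy, latticeK_eq (by linarith), latticeK_eq (by linarith), mul_div_assoc 2 α]
  rw [mul_div_assoc] at h3
  linarith

theorem latticeEnergy_pos {α : ℝ} (hα : 2 ≤ α) (z : ℍ) :
    0 < latticeEnergy α (2 * Real.sqrt 2) z := by
  obtain ⟨g, hg⟩ := ModularGroup.exists_smul_mem_fd z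
  rw [← latticeEnergy_smul _ _ g]
  apply latticeEnergy_pos_of_half_le_im hα
  -- On the fundamental domain `Im z ≥ √3/2 > 1/2`.
  nlinarith [ModularGroup.three_le_four_mul_im_sq_of_mem_fd hg, (g • z).im_pos]

/-! ### Limits at the cusp -/

theorem mul_exp_neg_le {c Q : ℝ} (hc : 0 < c) (hQ : 0 < Q) :
    Q * Real.exp (-(c * Q)) ≤ 720 / c ^ 6 / Q ^ 5 := by
  have h := Real.pow_div_factorial_le_exp (c * Q) (by positivity) 6
  have h6 : ((Nat.factorial 6 : ℕ) : ℝ) = 720 := by norm_num [Nat.factorial]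
  rw [h6] at h
  rw [Real.exp_neg, ← div_eq_mul_inv]
  calc Q / Real.exp (c * Q) ≤ Q / ((c * Q) ^ 6 / 720) := by gcongr
    _ = 720 / c ^ 6 / Q ^ 5 := by field_simp

/-- With `N = |mz + n|`, the bound `Q ^ (-5)` supplies `y ^ 5 / N ^ 10`. Six factors `N ≥ y` leave
`1/y`; the other four, `N ≥ r M`, give a convergent sum over the lattice. -/
theorem exists_latticeKOff_le {α : ℝ} (hα : 0 < α) :
    ∃ C : ℝ, ∀ z : ℍ, 1 ≤ z.im → latticeKOff α z ≤ C / z.im := by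
  -- The corner `1 + i` makes `r` a uniform lower constant on the strip `|Re z| ≤ 1`, `Im z ≥ 1`.
  set w : ℍ := ⟨⟨1, 1⟩, one_pos⟩
  set r := EisensteinSeries.r w
  have hr0 : 0 < r := EisensteinSeries.r_pos w
  set c := Real.pi * α
  have hc0 : 0 < c := mul_pos Real.pi_pos hα
  have hS : Summable fun p : ℤ × ℤ => 1 / ‖![p.1, p.2]‖ ^ 4 := by
    have h := (finTwoArrowEquiv ℤ).symm.summable_iff.mpr
      (EisensteinSeries.summable_one_div_norm_rpow (k := 4) (by norm_num))
    refine h.congr fun p => ?_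
    simp only [Function.comp_apply, finTwoArrowEquiv_symm_apply, Matrix.vecCons]
    rw [Real.rpow_neg (norm_nonneg _), one_div]
    congr 1
    exact_mod_cast (Real.rpow_natCast _ 4)
  have strip : ∀ z : ℍ, 1 ≤ z.im → |z.re| ≤ 1 →
      latticeKOff α z ≤ 720 / c ^ 6 / r ^ 4 * (∑' p : ℤ × ℤ, 1 / ‖![p.1, p.2]‖ ^ 4) / z.im := by
    intro z hz hre
    have hy := z.im_pos
    rw [mul_div_right_comm, ← tsum_mul_left]
    refine Summable.tsum_le_tsum (fun p => ?_) (summable_latticeKOff hα z) (hS.mul_left _)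
    split_ifs with hp
    · positivity
    · set N := ‖(p.1 : ℂ) * (z : ℂ) + (p.2 : ℂ)‖ with hN
      set M := ‖![p.1, p.2]‖ with hM
      have hne : ![p.1, p.2] ≠ 0 := fun h => hp (by simpa using congrFun h 0)
      have hM0 : 0 < M := norm_pos_iff.mpr hne
      have h1 : r * M ≤ N := by
        refine le_trans ?_ (by simpa using EisensteinSeries.r_mul_max_le z hne)
        gcongr
        exact EisensteinSeries.r_lower_bound_on_verticalStrip z one_pos ⟨hre, hz⟩
      have h2 : z.im ≤ N := im_le_norm hp z
      have hN0 : 0 < N := hy.trans_le h2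
      have hQ : latticeNormSq z p = N ^ 2 / z.im := rfl
      rw [hQ]
      refine (mul_exp_neg_le hc0 (by positivity)).trans ?_
      calc 720 / c ^ 6 / (N ^ 2 / z.im) ^ 5
          = 720 / c ^ 6 * z.im ^ 5 / (N ^ 6 * N ^ 4) := by field_simp
        _ ≤ 720 / c ^ 6 * z.im ^ 5 / (z.im ^ 6 * (r * M) ^ 4) := by gcongr
        _ = 720 / c ^ 6 / r ^ 4 / z.im * (1 / M ^ 4) := by field_simp
  refine ⟨720 / c ^ 6 / r ^ 4 * ∑' p : ℤ × ℤ, 1 / ‖![p.1, p.2]‖ ^ 4, fun z hz => ?_⟩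
  -- An integer translation moves `z` into the strip, so the bound is uniform in `Re z`.
  have h := strip (((-⌊z.re⌋ : ℤ) : ℝ) +ᵥ z) (by simpa using hz) (by
    rw [vadd_re, abs_le]
    push_cast
    constructor <;> linarith [Int.floor_le z.re, Int.lt_floor_add_one z.re])
  rwa [latticeKOff_vadd hα, vadd_im] at h

theorem tendsto_latticeKOff {α : ℝ} (hα : 0 < α) : Tendsto (latticeKOff α) atImInfty (𝓝 0) := by
  obtain ⟨C, hC⟩ := exists_latticeKOff_le hα
  have him : Tendsto UpperHalfPlane.im atImInfty atTop := tendsto_comap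
  refine squeeze_zero' (Eventually.of_forall (latticeKOff_nonneg α)) ?_
    (him.const_div_atTop C)
  filter_upwards [him.eventually_ge_atTop 1] with z hz using hC z hz

theorem tendsto_div_im {α : ℝ} (hα : 0 < α) :
    Tendsto (fun z : ℍ => α / z.im) atImInfty (𝓝[>] 0) := by
  have him : Tendsto UpperHalfPlane.im atImInfty atTop := tendsto_comap
  exact tendsto_nhdsWithin_iff.mpr
    ⟨him.const_div_atTop α, Eventually.of_forall fun z => div_pos hα z.im_pos⟩

theorem tendsto_latticeK_atTop {α : ℝ} (hα : 0 < α) : Tendsto (latticeK α) atImInfty atTop := by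
  have h := (tendsto_mul_thetaMoment_atTop.comp (tendsto_div_im hα)).const_mul_atTop
    (inv_pos.mpr hα)
  refine tendsto_atTop_mono (fun z => ?_) h
  have hz := z.im_pos
  have e : α⁻¹ * (α / z.im * thetaMoment (α / z.im)) = thetaMoment (α / z.im) / z.im := by
    field_simp
  rw [latticeK_eq hα, Function.comp_apply, e]
  linarith [latticeKOff_nonneg α z]

theorem tendsto_latticeEnergy {α : ℝ} (hα : 2 ≤ α) :
    Tendsto (latticeEnergy α (2 * Real.sqrt 2)) atImInfty (𝓝[>] 0) := by
  refine tendsto_nhdsWithin_iff.mpr ⟨?_, Eventually.of_forall (latticeEnergy_pos hα)⟩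
  have hα0 : 0 < α := by linarith
  have h1 := (tendsto_thetaMoment_sub.comp (tendsto_div_im hα0)).const_mul α⁻¹
  have h2 := (tendsto_latticeKOff hα0).sub
    ((tendsto_latticeKOff (show 0 < 2 * α by linarith)).const_mul (2 * Real.sqrt 2))
  have h3 := h1.add h2
  simp only [mul_zero, sub_zero, add_zero] at h3
  refine h3.congr fun z => ?_
  have hz := z.im_pos
  rw [latticeEnergy, latticeK_eq hα0, latticeK_eq (by linarith), mul_div_assoc 2 α]
  simp only [Function.comp_apply]
  field_simp
  ring

theorem tendsto_latticeEnergy_atBot {α b : ℝ} (hα : 2 ≤ α) (hb : 2 * Real.sqrt 2 < b) :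
    Tendsto (latticeEnergy α b) atImInfty atBot := by
  have h1 := (tendsto_nhdsWithin_iff.mp (tendsto_latticeEnergy hα)).1
  have h2 := (tendsto_latticeK_atTop (show 0 < 2 * α by linarith)).const_mul_atTop_of_neg
    (sub_neg.mpr hb)
  refine (h1.add_atBot h2).congr fun z => ?_
  simp only [latticeEnergy]
  ring

theorem proposition5p1 (α : ℝ) (hα : 2 ≤ α) :
    (∀ b : ℝ, 2 * Real.sqrt 2 ≤ b →
      ¬ ∃ z₀ : ℍ, IsMinOn (latticeEnergy α b) Set.univ z₀) ∧
    (∀ b : ℝ, 2 * Real.sqrt 2 < b →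
      Tendsto (latticeEnergy α b) UpperHalfPlane.atImInfty atBot) ∧
    Tendsto (latticeEnergy α (2 * Real.sqrt 2)) UpperHalfPlane.atImInfty (𝓝[>] 0) ∧
    (∀ z ∈ GammaC, 0 < latticeEnergy α (2 * Real.sqrt 2) z) := by
  refine ⟨?_, fun b hb => tendsto_latticeEnergy_atBot hα hb, tendsto_latticeEnergy hα,
    fun z _ => latticeEnergy_pos hα z⟩
  rintro b hb ⟨z₀, hz₀⟩
  -- At `b = 2√2` the value at `z₀` is positive but the limit is `0`; for larger `b` the energy is
  -- unbounded below.
  have hlt : ∃ z, latticeEnergy α b z < latticeEnergy α b z₀ := by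
    rcases hb.eq_or_lt with rfl | hb
    · exact (((tendsto_nhdsWithin_iff.mp (tendsto_latticeEnergy hα)).1).eventually_lt_const
        (latticeEnergy_pos hα z₀)).exists
    · exact ((tendsto_latticeEnergy_atBot hα hb).eventually_lt_atBot _).exists
  obtain ⟨z, hz⟩ := hlt
  exact hz.not_ge (hz₀ (Set.mem_univ z))
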